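/- There are absolute constants $c, c' > 0$ such that the following holds. Setting. Let $0 \le r < p$, let $z_1,\dots,z_n$ be i.i.d. random observations, and let $f_i(\theta) = \varphi(z_i,\theta)$, $\theta\in\mathbb{R}^p$, be (almost surely) twice differentiable. Put $f = \frac1n\sum_{i=1}^n f_i$ and, for $\emptyset \neq S \subset [n]$, $H_S(\theta) = \frac{1}{|S|}\sum_{i\in S}\nabla^2 f_i(\theta)$. Let $\mathcal{C}\subset\mathbb{R}^p$ be convex and bounded. Assume that there are deterministic constants $M_1,\dots,M_n$ and $K>0$ such that almost surely $$\|H_S(\theta)-H_S(\theta')\|_2 \le M_{|S|}\,\|\theta-\theta'\|_2 \quad\text{for all } \emptyset\ne S\subset[n],\ \theta,\theta'\in\mathcal{C},$$ $$\max_{i\le n}\|\nabla^2 f_i(\theta)\|_2\le K \quad\text{for all } \theta\in\mathcal{C}.$$ Algorithm (NewSamp with sequentially dependent sub-sampling). Let $S_0,S_1,\dots\subset[n]$ be nonempty random sets, whose distributions may depend on the previous sets, such that the sequence $(S_\tau)_\tau$ is independent of the data $(z_1,\dots,z_n)$. Start at $\hat\theta^0\in\mathcal{C}$. At step $t$ let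 $\lambda^t_1\ge\dots\ge\lambda^t_p$ be the eigenvalues of $H_{S_t}(\hat\theta^t)$, with orthonormal eigenvectors $u_1,\dots,u_p$, let $$Q^t = \frac{1}{\lambda^t_{r+1}} I + \sum_{i=1}^{r}\Big(\frac1{\lambda^t_i}-\frac1{\lambda^t_{r+1}}\Big)u_iu_i^T ,$$ and let $\hat\theta^{t+1}$ be the Euclidean projection of $\hat\theta^t-\eta_t Q^t\nabla f(\hat\theta^t)$ onto $\mathcal{C}$, where the step size $\eta_t \ge 0$ may depend on all the randomness. Conclusion. Let $\theta_*$ be a minimizer of $f$ over $\mathbb{R}^p$, and let $\mathcal{E}=\{\theta_*\in\mathcal{C}\}$ with $\mathbb{P}(\mathcal{E})>0$. Fix $t\ge 0$ and assume that $$\frac{\mathrm{diam}(\mathcal{C})^2(M_n+M_{|S_t|})^2|S_t|}{K^2}\ \ge\ e .$$ Then, conditioned on $\mathcal{E}$, with probability at least $1-\frac{c}{\mathbb{P}(\mathcal{E})}e^{-p}$: if $\lambda^t_{r+1}>0$ and $\eta_t \le \dfrac{2}{1+\lambda^t_p/\lambda^t_{r+1}}$, then $$\|\hat\theta^{t+1}-\theta_*\|_2\le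 \xi_1^t\,\|\hat\theta^t-\theta_*\|_2+\xi_2^t\,\|\hat\theta^t-\theta_*\|_2^2,$$ where $$\xi_1^t = 1-\eta_t\frac{\lambda^t_p}{\lambda^t_{r+1}}+\eta_t\frac{c'K}{\lambda^t_{r+1}}\sqrt{\frac{p}{|S_t|}\log\Big(\frac{\mathrm{diam}(\mathcal{C})^2(M_n+M_{|S_t|})^2|S_t|}{K^2}\Big)},\qquad \xi_2^t=\eta_t\frac{M_n}{2\lambda^t_{r+1}} .$$ -/

import Mathlib

open MeasureTheory ProbabilityTheory

noncomputable section

namespace NewSamp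

/-- The parameter space `ℝ^p` with its Euclidean norm. -/
abbrev Param (p : ℕ) : Type := EuclideanSpace ℝ (Fin p)

/-- `g` is twice differentiable on `ℝ^p`. -/
def TwiceDifferentiable {p : ℕ} (g : Param p → ℝ) : Prop :=
  Differentiable ℝ g ∧ Differentiable ℝ (gradient g)

/-- The Hessian of `g` at `θ`, as a linear operator on `ℝ^p`; the norm of such an operator is the
spectral norm. -/
def hessian {p : ℕ} (g : Param p → ℝ) (θ : Param p) : Param p →L[ℝ] Param p :=
  fderiv ℝ (gradient g) θ

/-- The objective `f(θ) = (1/n) ∑ i, f_i(θ)`. -/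
def objective {n p : ℕ} (f : Fin n → Param p → ℝ) (θ : Param p) : ℝ :=
  (n : ℝ)⁻¹ * ∑ i, f i θ

/-- The sub-sampled Hessian `H_S(θ) = (1/|S|) ∑ i ∈ S, ∇² f_i(θ)`. -/
def subHessian {n p : ℕ} (f : Fin n → Param p → ℝ) (S : Finset (Fin n)) (θ : Param p) :
    Param p →L[ℝ] Param p :=
  (S.card : ℝ)⁻¹ • ∑ i ∈ S, hessian (f i) θ

/-- Eigenvalues in decreasing order, with multiplicity, and an orthonormal basis of corresponding
eigenvectors. The index is `0`-based: the `(i+1)`-st largest eigenvalue is `lam i`. -/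
structure IsEigenDecomposition {p : ℕ} (A : Param p →L[ℝ] Param p) (lam : Fin p → ℝ)
    (u : OrthonormalBasis (Fin p) ℝ (Param p)) : Prop where
  antitone : Antitone lam
  eigen : ∀ i, A (u i) = lam i • u i

/-- The `(r+1)`-st largest eigenvalue `λ_{r+1}`, for a rank threshold `r < p`. -/
def thresholdEigenvalue {p r : ℕ} (hr : r < p) (lam : Fin p → ℝ) : ℝ := lam ⟨r, hr⟩

/-- The smallest eigenvalue `λ_p`. -/
def smallestEigenvalue {p r : ℕ} (hr : r < p) (lam : Fin p → ℝ) : ℝ := lam ⟨p - 1, by omega⟩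

/-- `Q = λ_{r+1}⁻¹ I + U_r (Λ_r⁻¹ - λ_{r+1}⁻¹ I) U_rᵀ`, where the columns of `U_r` are the top `r`
eigenvectors: `U_r D U_rᵀ = ∑ i < r, D_i u_i u_iᵀ` for diagonal `D`. -/
def scalingMatrix {p r : ℕ} (hr : r < p) (lam : Fin p → ℝ)
    (u : OrthonormalBasis (Fin p) ℝ (Param p)) : Param p →L[ℝ] Param p :=
  (thresholdEigenvalue hr lam)⁻¹ • ContinuousLinearMap.id ℝ (Param p) +
    ∑ i ∈ Finset.univ.filter (fun i : Fin p => (i : ℕ) < r),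
      ((lam i)⁻¹ - (thresholdEigenvalue hr lam)⁻¹) • InnerProductSpace.rankOne ℝ (u i) (u i)

/-- `w` is a Euclidean projection of `v` onto `C`: `w ∈ argmin_{w' ∈ C} ‖v - w'‖`. -/
def IsProjection {p : ℕ} (C : Set (Param p)) (v w : Param p) : Prop :=
  w ∈ C ∧ ∀ w' ∈ C, ‖v - w‖ ≤ ‖v - w'‖

/-- One NewSamp iteration from `θ` to `θ'`, with sub-sample `S`, step size `η` and rank threshold
`r`; `lam` and `u` are the eigenvalues and eigenvectors of the sub-sampled Hessian at `θ`. -/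
structure IsStep {n p r : ℕ} (f : Fin n → Param p → ℝ) (C : Set (Param p)) (hr : r < p)
    (S : Finset (Fin n)) (η : ℝ) (lam : Fin p → ℝ) (u : OrthonormalBasis (Fin p) ℝ (Param p))
    (θ θ' : Param p) : Prop where
  eigen : IsEigenDecomposition (subHessian f S θ) lam u
  update : IsProjection C (θ - η • scalingMatrix hr lam u (gradient (objective f) θ)) θ'

/-- The ratio `diam(C)² (M_n + M_m)² m / K²` for Lipschitz constants `M` and sub-sample size `m`. -/
def logArgument {p : ℕ} (C : Set (Param p)) (M : ℕ → ℝ) (K : ℝ) (n m : ℕ) : ℝ :=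
  Metric.diam C ^ 2 * (M n + M m) ^ 2 * m / K ^ 2

/-- The coefficient of the linear term. -/
def xi₁ {p r : ℕ} (c' : ℝ) (hr : r < p) (C : Set (Param p)) (M : ℕ → ℝ) (K : ℝ) (n m : ℕ)
    (η : ℝ) (lam : Fin p → ℝ) : ℝ :=
  1 - η * (smallestEigenvalue hr lam / thresholdEigenvalue hr lam) +
    η * (c' * K / thresholdEigenvalue hr lam) *
      Real.sqrt ((p : ℝ) / m * Real.log (logArgument C M K n m))

/-- The coefficient of the quadratic term. -/
def xi₂ {p r : ℕ} (hr : r < p) (M : ℕ → ℝ) (n : ℕ) (η : ℝ) (lam : Fin p → ℝ) : ℝ :=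
  η * (M n / (2 * thresholdEigenvalue hr lam))

/-- `A` holds with probability at least `q` under the probability measure `μ`. For a set `A` that
is not known to be measurable this is the strong reading: the complement of `A` has outer
measure at most `1 - q`. -/
def HoldsWithProbAtLeast {Ω : Type*} [MeasurableSpace Ω] (μ : Measure Ω) (q : ℝ) (A : Set Ω) :
    Prop :=
  μ Aᶜ ≤ ENNReal.ofReal (1 - q)

end NewSamp

end

/-!
Write `θ = θhat t`, `S = S t`, `x = θ - θstar`. On the event `θstar ∈ C` the projection onto the convex
set `C` only decreases the distance to `θstar` (`IsProjection.norm_sub_le`), and the unprojected step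
satisfies
`θ - η Q ∇f(θ) - θstar = (I - η Q H_S) x + η Q (H_S - H_[n]) x + η Q (H_[n] x - ∇f(θ))`,
all Hessians being taken at `θ`. The first operator and `Q` are diagonal in the eigenbasis of `H_S`; the
step size condition makes the norm of the first at most `1 - η λ_p / λ_{r+1}`, and `Q` has norm at most
`1 / λ_{r+1}`. The last bracket is at most `M_n / 2 * ‖x‖ ^ 2`, because `∇f(θstar) = 0` and `H_[n]` is
Lipschitz on `C`. This is `IsStep.norm_sub_le`, and it leaves only `‖H_S(θ) - H_[n](θ)‖` to be bounded.

Since `θ` depends on the data, that norm is bounded uniformly over `C`, for each fixed value `s` of `S`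
(`exists_measurableSet_subHessian_deviation`). The difference is `∑ i, w i • ∇²f_i` with weights `w` of
sum zero and square sum at most `1 / |s|`, so the unknown mean cancels and Hoeffding's inequality applies
to `∑ i, w i * ⟪u, ∇²f_i(θ₀) v⟫` directly, for fixed `θ₀`, `u`, `v`. A union bound over `1/2`-nets of
the unit ball for `u` and `v`, and over a net of `C` for `θ₀` whose mesh is so fine that the Lipschitz
condition makes the discretization error at most `K / √|s|`, gives a failure probability of at most
`exp (-p)`. The sizes of the nets come from comparing volumes (`exists_finset_net`).

The random sub-sample is finitely valued and independent of the data, so the exceptional sets for the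
different values of `S` still combine to an event of probability at most `exp (-p)`
(`measure_iUnion_inter_le_of_indepFun`); conditioning on an event `E` costs a factor `1 / P(E)`.
-/

namespace NewSamp

open Module Metric

/-! ### Nets in bounded sets -/

/-- Volume bound: the balls of radius `δ / 2` about the points of `s` are disjoint and lie in one ball
of radius `diam C + δ / 2`. -/
theorem card_le_of_separated_of_isBounded {E : Type*} [NormedAddCommGroup E] [NormedSpace ℝ E]
    [FiniteDimensional ℝ E] {C : Set E} (hC : Bornology.IsBounded C) {δ : ℝ} (hδ : 0 < δ)
    (s : Finset E) (hsC : (s : Set E) ⊆ C)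
    (hs : ∀ x ∈ s, ∀ y ∈ s, x ≠ y → δ < ‖x - y‖) :
    (s.card : ℝ) ≤ (1 + 2 * diam C / δ) ^ finrank ℝ E := by
  rcases s.eq_empty_or_nonempty with rfl | ⟨x₀, hx₀⟩
  · simp only [Finset.card_empty, Nat.cast_zero]
    have : 0 ≤ diam C := diam_nonneg
    positivity
  borelize E
  let μ : Measure E := Measure.addHaar
  have hd : 0 ≤ diam C := diam_nonneg
  have hρ : 0 < diam C + δ / 2 := by positivity
  have hδ2 : 0 < δ / 2 := by positivity
  have hdisj : Set.Pairwise (s : Set E) (Function.onFun Disjoint fun c => ball (c : E) (δ / 2)) := by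
    intro c hc d hd hcd
    apply ball_disjoint_ball
    rw [dist_eq_norm]
    linarith [hs c hc d hd hcd]
  have hsub : (⋃ c ∈ s, ball c (δ / 2)) ⊆ ball x₀ (diam C + δ / 2) := by
    refine Set.iUnion₂_subset fun x hx => ball_subset_ball' ?_
    linarith [dist_le_diam_of_mem hC (hsC hx) (hsC hx₀)]
  have I : (s.card : ENNReal) * ENNReal.ofReal ((δ / 2) ^ finrank ℝ E) * μ (ball 0 1) ≤
      ENNReal.ofReal ((diam C + δ / 2) ^ finrank ℝ E) * μ (ball 0 1) := by
    calc _ = μ (⋃ c ∈ s, ball c (δ / 2)) := by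
          rw [measure_biUnion_finset hdisj fun c _ => measurableSet_ball]
          simp only [μ.addHaar_ball_of_pos _ hδ2, Finset.sum_const, nsmul_eq_mul, mul_assoc]
      _ ≤ μ (ball x₀ (diam C + δ / 2)) := measure_mono hsub
      _ = _ := by simp only [μ.addHaar_ball_of_pos _ hρ]
  have J := (ENNReal.mul_le_mul_iff_left (measure_ball_pos μ _ zero_lt_one).ne'
    measure_ball_lt_top.ne).1 I
  have J' := ENNReal.toReal_le_of_le_ofReal (pow_nonneg hρ.le _) J
  rw [ENNReal.toReal_mul, ENNReal.toReal_natCast,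
    ENNReal.toReal_ofReal (pow_nonneg hδ2.le _)] at J'
  have : 1 + 2 * diam C / δ = (diam C + δ / 2) / (δ / 2) := by field_simp; ring
  rw [this, div_pow, le_div_iff₀ (pow_pos hδ2 _)]
  exact J'

/-- A largest `δ`-separated subset of `C` is a `δ`-net, with centres in `C` itself. -/
theorem exists_finset_net {E : Type*} [NormedAddCommGroup E] [NormedSpace ℝ E]
    [FiniteDimensional ℝ E] {C : Set E} (hC : Bornology.IsBounded C) {δ : ℝ} (hδ : 0 < δ) :
    ∃ N : Finset E, (N : Set E) ⊆ C ∧ (N.card : ℝ) ≤ (1 + 2 * diam C / δ) ^ finrank ℝ E ∧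
      ∀ x ∈ C, ∃ y ∈ N, ‖x - y‖ ≤ δ := by
  classical
  let T : Set ℕ := {k | ∃ s : Finset E, (s : Set E) ⊆ C ∧
    (∀ x ∈ s, ∀ y ∈ s, x ≠ y → δ < ‖x - y‖) ∧ s.card = k}
  have hT0 : T.Nonempty := ⟨0, ∅, by simp⟩
  have hTb : BddAbove T := by
    refine ⟨⌊(1 + 2 * diam C / δ) ^ finrank ℝ E⌋₊, ?_⟩
    rintro k ⟨s, h1, h2, rfl⟩
    exact Nat.le_floor (card_le_of_separated_of_isBounded hC hδ s h1 h2)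
  obtain ⟨N, h1, h2, h3⟩ := Nat.sSup_mem hT0 hTb
  refine ⟨N, h1, card_le_of_separated_of_isBounded hC hδ N h1 h2, fun x hx => ?_⟩
  -- a point of `C` far from `N` would extend `N` to a larger separated set
  by_contra! hcon
  have hxN : x ∉ N := fun h => by have := hcon x h; simp at this; linarith
  have hmem : (insert x N).card ∈ T := by
    refine ⟨insert x N, ?_, ?_, rfl⟩
    · simp [Set.insert_subset_iff, hx, h1]
    · intro a ha b hb hab
      rcases Finset.mem_insert.1 ha with rfl | ha <;> rcases Finset.mem_insert.1 hb with rfl | hb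
      · exact absurd rfl hab
      · exact hcon b hb
      · rw [norm_sub_rev]; exact hcon a ‹_›
      · exact h2 a ha b hb hab
  have := le_csSup hTb hmem
  rw [← h3, Finset.card_insert_of_notMem hxN] at this
  omega

/-- The operator norm is controlled by the bilinear form on a `1/2`-net of the unit ball. One-sided
bounds are enough, and `A` need not be self-adjoint. -/
theorem norm_le_four_mul_of_inner_net_le {E : Type*} [NormedAddCommGroup E] [InnerProductSpace ℝ E]
    {N : Set E} (hN : ∀ x ∈ closedBall (0 : E) 1, ∃ y ∈ N, ‖x - y‖ ≤ 1 / 2) (A : E →L[ℝ] E) {b : ℝ}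
    (hb : 0 ≤ b) (h : ∀ x ∈ N, ∀ y ∈ N, inner ℝ x (A y) ≤ b) : ‖A‖ ≤ 4 * b := by
  have h2 : ∀ y ∈ N, ‖A y‖ ≤ 2 * b := by
    intro y hy
    rcases eq_or_ne (A y) 0 with h0 | h0
    · rw [h0, norm_zero]; positivity
    have hn : 0 < ‖A y‖ := norm_pos_iff.2 h0
    obtain ⟨x, hx, hxd⟩ := hN (‖A y‖⁻¹ • A y) (by
      rw [mem_closedBall_zero_iff, norm_smul, norm_inv, norm_norm, inv_mul_cancel₀ hn.ne'])
    have e1 : inner ℝ (‖A y‖⁻¹ • A y) (A y) = ‖A y‖ := by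
      rw [real_inner_smul_left, real_inner_self_eq_norm_sq]; field_simp
    have e2 : inner ℝ (‖A y‖⁻¹ • A y - x) (A y) ≤ 1 / 2 * ‖A y‖ :=
      (real_inner_le_norm _ _).trans (by gcongr)
    rw [inner_sub_left, e1] at e2
    linarith [h x hx y hy]
  have h3 : ‖A‖ ≤ 2 * b + 1 / 2 * ‖A‖ := by
    refine A.opNorm_le_of_unit_norm (by positivity) fun x hx => ?_
    obtain ⟨y, hy, hxy⟩ := hN x (by simp [hx])
    calc ‖A x‖ = ‖A y + A (x - y)‖ := by rw [← map_add]; simp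
      _ ≤ ‖A y‖ + ‖A (x - y)‖ := norm_add_le _ _
      _ ≤ 2 * b + ‖A‖ * (1 / 2) := by
          gcongr
          · exact h2 y hy
          · exact (A.le_opNorm _).trans (by gcongr)
      _ = _ := by ring
  linarith

/-! ### One step of the algorithm -/

/-- Projection onto a convex set does not increase the distance to points of that set. The set need not
be closed, since the projection is given. -/
theorem IsProjection.norm_sub_le {p : ℕ} {C : Set (Param p)} (hC : Convex ℝ C) {v w x : Param p}
    (h : IsProjection C v w) (hx : x ∈ C) : ‖w - x‖ ≤ ‖v - x‖ := by
  have : Nonempty C := ⟨⟨w, h.1⟩⟩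
  have h1 : ‖v - w‖ = ⨅ y : C, ‖v - y‖ :=
    le_antisymm (le_ciInf fun y => h.2 y y.2)
      (ciInf_le (f := fun y : C => ‖v - y‖) ⟨0, by rintro _ ⟨y, rfl⟩; exact norm_nonneg _⟩ ⟨w, h.1⟩)
  have h2 := (norm_eq_iInf_iff_real_inner_le_zero hC h.1).1 h1 x hx
  have h3 : ‖v - x‖ ^ 2 = ‖v - w‖ ^ 2 - 2 * inner ℝ (v - w) (x - w) + ‖w - x‖ ^ 2 := by
    rw [show v - x = (v - w) - (x - w) by abel, norm_sub_sq_real, norm_sub_rev x w]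
  nlinarith [norm_nonneg (v - x), norm_nonneg (w - x), sq_nonneg ‖v - w‖]

theorem norm_apply_le_of_orthonormalBasis_eigen {p : ℕ} (u : OrthonormalBasis (Fin p) ℝ (Param p))
    (A : Param p →L[ℝ] Param p) (d : Fin p → ℝ) (hA : ∀ i, A (u i) = d i • u i) {c : ℝ}
    (hc : 0 ≤ c) (hd : ∀ i, |d i| ≤ c) (x : Param p) : ‖A x‖ ≤ c * ‖x‖ := by
  have h1 : ∀ i, inner ℝ (u i) (A x) = d i * inner ℝ (u i) x := by
    intro i
    conv_lhs => rw [← u.sum_repr' x]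
    simp only [map_sum, map_smul, hA, inner_sum, real_inner_smul_right]
    rw [Finset.sum_eq_single i]
    · simp [u.orthonormal.1 i]; ring
    · intro j _ hj
      rw [u.orthonormal.2 (Ne.symm hj)]; simp
    · simp
  have h2 : ‖A x‖ ^ 2 ≤ (c * ‖x‖) ^ 2 := by
    rw [mul_pow, ← u.sum_sq_norm_inner_right, ← u.sum_sq_norm_inner_right x, Finset.mul_sum]
    refine Finset.sum_le_sum fun i _ => ?_
    rw [h1, norm_mul, mul_pow]
    have : ‖d i‖ ≤ c := hd i
    gcongr
  exact le_of_sq_le_sq h2 (by positivity)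

theorem scalingMatrix_apply_basis {p r : ℕ} (hr : r < p) (lam : Fin p → ℝ)
    (u : OrthonormalBasis (Fin p) ℝ (Param p)) (i : Fin p) :
    scalingMatrix hr lam u (u i) =
      (if (i : ℕ) < r then (lam i)⁻¹ else (thresholdEigenvalue hr lam)⁻¹) • u i := by
  have h : ∀ j, inner ℝ (u j) (u i) = if j = i then (1 : ℝ) else 0 :=
    fun j => orthonormal_iff_ite.1 u.orthonormal j i
  simp only [scalingMatrix, add_apply, smul_apply,
    ContinuousLinearMap.id_apply, sum_apply, InnerProductSpace.rankOne_apply, h,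
    ite_smul, one_smul, zero_smul, smul_ite, smul_zero, Finset.sum_ite_eq', Finset.mem_filter,
    Finset.mem_univ, true_and]
  split_ifs with hi
  · rw [← add_smul]; congr 1; ring
  · simp

/-- The eigenvalues of `Q` are positive and at most `1 / λ_{r+1}`. -/
theorem norm_scalingMatrix_apply_le {p r : ℕ} (hr : r < p) {lam : Fin p → ℝ} (hlam : Antitone lam)
    (u : OrthonormalBasis (Fin p) ℝ (Param p)) (h0 : 0 < thresholdEigenvalue hr lam) (x : Param p) :
    ‖scalingMatrix hr lam u x‖ ≤ (thresholdEigenvalue hr lam)⁻¹ * ‖x‖ := by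
  refine norm_apply_le_of_orthonormalBasis_eigen u _ _ (scalingMatrix_apply_basis hr lam u)
    (by positivity) (fun i => ?_) x
  split_ifs with hi
  · have : thresholdEigenvalue hr lam ≤ lam i := hlam (Fin.mk_le_mk.2 hi.le)
    rw [abs_of_pos (inv_pos.2 (h0.trans_le this))]
    gcongr
  · rw [abs_of_pos (by positivity)]

/-- The eigenvalues of `Q A` are `1` for `i < r` and `λ_i / λ_{r+1}` otherwise, so they lie between
`λ_p / λ_{r+1}` and `1`. The bound on `η` is what makes `η - 1 ≤ 1 - η λ_p / λ_{r+1}`. -/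
theorem norm_sub_smul_scalingMatrix_apply_le {p r : ℕ} (hr : r < p) {A : Param p →L[ℝ] Param p}
    {lam : Fin p → ℝ} {u : OrthonormalBasis (Fin p) ℝ (Param p)}
    (hA : IsEigenDecomposition A lam u) (h0 : 0 < thresholdEigenvalue hr lam) {η : ℝ} (hη : 0 ≤ η)
    (hη' : η ≤ 2 / (1 + smallestEigenvalue hr lam / thresholdEigenvalue hr lam)) (x : Param p) :
    ‖x - η • scalingMatrix hr lam u (A x)‖ ≤
      (1 - η * (smallestEigenvalue hr lam / thresholdEigenvalue hr lam)) * ‖x‖ := by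
  set lr := thresholdEigenvalue hr lam with hlr
  set lp := smallestEigenvalue hr lam with hlp
  -- if the denominator `1 + lp / lr` is not positive, the claim holds by signs alone
  have hkey : η * (1 + lp / lr) ≤ 2 := by
    rcases le_or_gt (1 + lp / lr) 0 with hle | hpos
    · nlinarith
    · rwa [le_div_iff₀ hpos] at hη'
  have hplr : lp / lr ≤ 1 := by
    rw [div_le_one h0]
    exact hA.antitone (Fin.mk_le_mk.2 (by omega))
  have hc : 0 ≤ 1 - η * (lp / lr) := by
    nlinarith [mul_le_mul_of_nonneg_left hplr hη]
  have := norm_apply_le_of_orthonormalBasis_eigen u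
    (ContinuousLinearMap.id ℝ (Param p) - η • (scalingMatrix hr lam u ∘L A))
    (fun i => 1 - η * (lam i * (if (i : ℕ) < r then (lam i)⁻¹ else lr⁻¹))) (fun i => by
      simp only [sub_apply, smul_apply,
        ContinuousLinearMap.id_apply, ContinuousLinearMap.comp_apply, hA.eigen, map_smul,
        scalingMatrix_apply_basis, ← hlr, smul_smul, sub_smul, one_smul]) hc
    (fun i => ?_) x
  · simpa using this
  have h1 : lp / lr ≤ lam i * (if (i : ℕ) < r then (lam i)⁻¹ else lr⁻¹) ∧
      lam i * (if (i : ℕ) < r then (lam i)⁻¹ else lr⁻¹) ≤ 1 := by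
    split_ifs with hi
    · have : lr ≤ lam i := hA.antitone (Fin.mk_le_mk.2 hi.le)
      rw [mul_inv_cancel₀ (h0.trans_le this).ne']
      exact ⟨hplr, le_rfl⟩
    · rw [← div_eq_mul_inv]
      refine ⟨?_, ?_⟩
      · have : lp ≤ lam i := hA.antitone (Fin.le_def.2 (by simp; omega))
        gcongr
      · rw [div_le_one h0]
        exact hA.antitone (Fin.le_def.2 (by simp; omega))
  have h2 := mul_le_mul_of_nonneg_left h1.1 hη
  have h3 := mul_le_mul_of_nonneg_left h1.2 hη
  rw [abs_le]
  constructor <;> nlinarith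

/-- First-order Taylor remainder at a zero `y` of `g`, for a Lipschitz derivative. -/
theorem norm_sub_apply_le_of_lipschitz_fderiv {E : Type*} [NormedAddCommGroup E] [NormedSpace ℝ E]
    {g : E → E} {H : E → E →L[ℝ] E} {C : Set E} (hC : Convex ℝ C)
    (hg : ∀ x ∈ C, HasFDerivAt g (H x) x) {M : ℝ}
    (hM : ∀ x ∈ C, ∀ y ∈ C, ‖H x - H y‖ ≤ M * ‖x - y‖) {x y : E} (hx : x ∈ C) (hy : y ∈ C)
    (hgy : g y = 0) : ‖H x (x - y) - g x‖ ≤ M / 2 * ‖x - y‖ ^ 2 := by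
  let γ : ℝ → E := fun s => x + s • (y - x)
  have hγ : ∀ s ∈ Set.Icc (0 : ℝ) 1, γ s ∈ C := fun s hs => by
    have := hC.add_smul_sub_mem hx hy hs; exact this
  have hγ' : ∀ s, HasDerivAt γ (y - x) s := fun s => by
    simpa [γ] using! ((hasDerivAt_id s).smul_const (y - x)).const_add x
  have hd : ∀ s ∈ Set.Icc (0 : ℝ) 1, HasDerivAt (fun s => g (γ s) - g x - s • H x (y - x))
      (H (γ s) (y - x) - H x (y - x)) s := fun s hs => by
    have h1 := ((hg _ (hγ s hs)).comp_hasDerivAt s (hγ' s)).sub_const (g x)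
    have h2 := (hasDerivAt_id s).smul_const (H x (y - x))
    simpa using! h1.sub h2
  -- the derivative along the segment is at most `M * ‖x - y‖ ^ 2 * s`, which integrates to the claim
  have key := image_norm_le_of_norm_deriv_right_le_deriv_boundary (a := 0) (b := 1)
    (B := fun s => M / 2 * ‖x - y‖ ^ 2 * s ^ 2) (B' := fun s => M * ‖x - y‖ ^ 2 * s)
    (fun s hs => (hd s hs).continuousAt.continuousWithinAt)
    (fun s hs => (hd s ⟨hs.1, hs.2.le⟩).hasDerivWithinAt) (by simp [γ])
    (fun s => by
      have := (hasDerivAt_pow 2 s).const_mul (M / 2 * ‖x - y‖ ^ 2)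
      exact this.congr_deriv (by push_cast; ring))
    (fun s hs => by
      rw [← sub_apply]
      have hs' : s ∈ Set.Icc (0 : ℝ) 1 := ⟨hs.1, hs.2.le⟩
      have e : ‖γ s - x‖ = s * ‖x - y‖ := by
        simp [γ, norm_smul, abs_of_nonneg hs.1, norm_sub_rev y x]
      calc _ ≤ ‖H (γ s) - H x‖ * ‖y - x‖ := ContinuousLinearMap.le_opNorm _ _
        _ ≤ M * ‖γ s - x‖ * ‖y - x‖ := by gcongr; exact hM _ (hγ s hs') _ hx
        _ = _ := by rw [e, norm_sub_rev y x]; ring) (Set.right_mem_Icc.2 zero_le_one)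
  have e : H x (x - y) - g x = g (γ 1) - g x - (1 : ℝ) • H x (y - x) := by
    have : γ 1 = y := by simp [γ]
    rw [this, hgy, ← neg_sub y x, map_neg]; simp; abel
  rw [e]; simpa using key

section Objective

variable {n p : ℕ} {f : Fin n → Param p → ℝ}

theorem gradient_objective (hf : ∀ i, TwiceDifferentiable (f i)) (θ : Param p) :
    gradient (objective f) θ = (n : ℝ)⁻¹ • ∑ i, gradient (f i) θ := by
  apply HasGradientAt.gradient
  rw [hasGradientAt_iff_hasFDerivAt]
  have h : HasFDerivAt (fun θ => (n : ℝ)⁻¹ * ∑ i, f i θ)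
      ((n : ℝ)⁻¹ • ∑ i, InnerProductSpace.toDual ℝ (Param p) (gradient (f i) θ)) θ := by
    refine HasFDerivAt.const_mul (HasFDerivAt.fun_sum fun i _ => ?_) _
    exact ((hf i).1 θ).hasGradientAt.hasFDerivAt
  simpa [map_sum] using! h

theorem hasFDerivAt_gradient_objective (hf : ∀ i, TwiceDifferentiable (f i)) (θ : Param p) :
    HasFDerivAt (gradient (objective f)) (subHessian f Finset.univ θ) θ := by
  rw [funext (gradient_objective hf)]
  simp only [subHessian, Finset.card_univ, Fintype.card_fin]
  have h : HasFDerivAt (fun θ => ∑ i, gradient (f i) θ) (∑ i, hessian (f i) θ) θ :=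
    HasFDerivAt.fun_sum fun i _ => ((hf i).2 θ).hasFDerivAt
  exact h.const_smul (n : ℝ)⁻¹

theorem gradient_objective_eq_zero {θ : Param p}
    (h : ∀ θ', objective f θ ≤ objective f θ') : gradient (objective f) θ = 0 := by
  have : IsLocalMin (objective f) θ := Filter.Eventually.of_forall h
  rw [gradient, this.fderiv_eq_zero, map_zero]

end Objective

/-- The one-step bound, given a bound `b` on the deviation of the sub-sampled Hessian from the full
one at the current iterate. -/
theorem IsStep.norm_sub_le {n p r : ℕ} {f : Fin n → Param p → ℝ} {C : Set (Param p)} {hr : r < p}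
    {S : Finset (Fin n)} {η : ℝ} {lam : Fin p → ℝ} {u : OrthonormalBasis (Fin p) ℝ (Param p)}
    {θ θ' θs : Param p} (h : IsStep f C hr S η lam u θ θ')
    (hf : ∀ i, TwiceDifferentiable (f i)) (hC : Convex ℝ C) (hθ : θ ∈ C) (hθs : θs ∈ C)
    (hmin : ∀ x, objective f θs ≤ objective f x) {M : ℕ → ℝ}
    (hM : ∀ x ∈ C, ∀ y ∈ C,
      ‖subHessian f Finset.univ x - subHessian f Finset.univ y‖ ≤ M n * ‖x - y‖)
    (h0 : 0 < thresholdEigenvalue hr lam) (hη : 0 ≤ η)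
    (hη' : η ≤ 2 / (1 + smallestEigenvalue hr lam / thresholdEigenvalue hr lam)) {b : ℝ}
    (hb : ‖subHessian f S θ - subHessian f Finset.univ θ‖ ≤ b) :
    ‖θ' - θs‖ ≤ (1 - η * (smallestEigenvalue hr lam / thresholdEigenvalue hr lam) +
      η * (b / thresholdEigenvalue hr lam)) * ‖θ - θs‖ + xi₂ hr M n η lam * ‖θ - θs‖ ^ 2 := by
  refine (h.update.norm_sub_le hC hθs).trans ?_
  set Q := scalingMatrix hr lam u
  set lr := thresholdEigenvalue hr lam
  set x := θ - θs with hx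
  set G := gradient (objective f) θ
  set HS := subHessian f S θ
  set H := subHessian f Finset.univ θ
  have e : θ - η • Q G - θs = (x - η • Q (HS x)) + (η • Q ((HS - H) x) + η • Q (H x - G)) := by
    rw [sub_apply, map_sub Q, map_sub Q, smul_sub, smul_sub, hx]; abel
  have hQ : ∀ y, ‖η • Q y‖ ≤ η * (lr⁻¹ * ‖y‖) := fun y => by
    rw [norm_smul, Real.norm_of_nonneg hη]
    exact mul_le_mul_of_nonneg_left (norm_scalingMatrix_apply_le hr h.eigen.antitone u h0 y) hη
  have h1 := norm_sub_smul_scalingMatrix_apply_le hr h.eigen h0 hη hη' x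
  have h2 : ‖(HS - H) x‖ ≤ b * ‖x‖ := ((HS - H).le_opNorm x).trans (by gcongr)
  have h3 : ‖H x - G‖ ≤ M n / 2 * ‖x‖ ^ 2 :=
    norm_sub_apply_le_of_lipschitz_fderiv hC (fun y _ => hasFDerivAt_gradient_objective hf y) hM
      hθ hθs (gradient_objective_eq_zero hmin)
  have h2' := (hQ ((HS - H) x)).trans
    (mul_le_mul_of_nonneg_left (mul_le_mul_of_nonneg_left h2 (inv_pos.2 h0).le) hη)
  have h3' := (hQ (H x - G)).trans
    (mul_le_mul_of_nonneg_left (mul_le_mul_of_nonneg_left h3 (inv_pos.2 h0).le) hη)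
  rw [e]
  refine (norm_add_le _ _).trans ((add_le_add h1 ((norm_add_le _ _).trans
    (add_le_add h2' h3'))).trans (le_of_eq ?_))
  change (1 - η * (smallestEigenvalue hr lam / lr)) * ‖x‖ + _ = _
  change _ = (1 - η * (smallestEigenvalue hr lam / lr) + η * (b / lr)) * ‖x‖ +
    η * (M n / (2 * lr)) * ‖x‖ ^ 2
  field_simp
  ring

/-! ### Concentration of weighted sums -/

/-- Hoeffding's inequality for weights that sum to zero: the common mean drops out. -/
theorem measureReal_weighted_sum_ge_le {Ω ι : Type*} [MeasurableSpace Ω] [Fintype ι] {P : Measure Ω}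
    [IsProbabilityMeasure P] {X : ι → Ω → ℝ} (hX : iIndepFun X P) (hm : ∀ i, AEMeasurable (X i) P)
    {K : ℝ} (hK : 0 ≤ K) (hb : ∀ i, ∀ᵐ ω ∂P, |X i ω| ≤ K) {m : ℝ} (hmean : ∀ i, P[X i] = m)
    {a : ι → ℝ} (ha : ∑ i, a i = 0) {v : ℝ} (hv : ∑ i, a i ^ 2 ≤ v) {ε : ℝ} (hε : 0 ≤ ε) :
    P.real {ω | ε ≤ ∑ i, a i * X i ω} ≤ Real.exp (-ε ^ 2 / (2 * (v * K ^ 2))) := by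
  have hv0 : 0 ≤ v := (Finset.sum_nonneg fun i _ => sq_nonneg (a i)).trans hv
  have h1 : ∀ i ∈ Finset.univ, HasSubgaussianMGF (fun ω => a i * (X i ω - m))
      ((a i ^ 2).toNNReal * (‖K - -K‖₊ / 2) ^ 2) P := fun i _ => by
    have := hasSubgaussianMGF_of_mem_Icc (hm i)
      ((hb i).mono fun ω h => Set.mem_Icc.2 (abs_le.1 h))
    rw [hmean i] at this
    convert! this.const_mul (a i)
    exact congrArg _ (Real.toNNReal_of_nonneg (sq_nonneg _))
  have h2 : iIndepFun (fun i ω => a i * (X i ω - m)) P :=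
    hX.comp (fun i x => a i * (x - m)) fun i => by fun_prop
  have h3 := HasSubgaussianMGF.sum_of_iIndepFun h2 h1
  -- enlarging the variance proxy to `v * K ^ 2` avoids the junk quotient for zero variance
  have h4 : HasSubgaussianMGF (fun ω => ∑ i, a i * (X i ω - m)) (v * K ^ 2).toNNReal P := by
    refine ⟨h3.integrable_exp_mul, fun t => (h3.mgf_le t).trans ?_⟩
    have hKK : |K - -K| / 2 = K := by rw [abs_of_nonneg (by linarith)]; ring
    gcongr
    rw [← Finset.sum_mul, Real.le_toNNReal_iff_coe_le (by positivity)]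
    simp only [NNReal.coe_mul, NNReal.coe_sum, Real.coe_toNNReal _ (sq_nonneg _), NNReal.coe_pow,
      NNReal.coe_div, coe_nnnorm, Real.norm_eq_abs, NNReal.coe_ofNat, hKK]
    gcongr
  have h5 := h4.measure_ge_le hε
  have h6 : ∀ ω, ∑ i, a i * (X i ω - m) = ∑ i, a i * X i ω := fun ω => by
    simp only [mul_sub, Finset.sum_sub_distrib, ← Finset.sum_mul, ha]; ring
  simpa only [h6, Real.coe_toNNReal _ (show 0 ≤ v * K ^ 2 by positivity)] using h5

/-! ### Measurability of the Hessian in the data -/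

section Measurability

variable {p : ℕ}

/-- The derivative of `g` at `θ` in the direction `v`, computed along the steps `1 / (k + 1)`.
Unlike `fderiv`, it is measurable in a parameter of `g` whether or not `g` is differentiable for every
value of the parameter; the `limsup` is the limit where `g` is differentiable. -/
noncomputable def seqLineDeriv (g : Param p → ℝ) (v θ : Param p) : ℝ :=
  Filter.limsup (fun k : ℕ => ((k : ℝ) + 1) * (g (θ + ((k : ℝ) + 1)⁻¹ • v) - g θ)) Filter.atTop

theorem seqLineDeriv_eq_fderiv {g : Param p → ℝ} {θ : Param p} (hg : DifferentiableAt ℝ g θ)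
    (v : Param p) : seqLineDeriv g v θ = fderiv ℝ g θ v := by
  refine Filter.Tendsto.limsup_eq ?_
  have h := (hg.hasFDerivAt.hasLineDerivAt v).tendsto_slope_zero
  have h0 : Filter.Tendsto (fun k : ℕ => ((k : ℝ) + 1)⁻¹) Filter.atTop (nhdsWithin 0 {0}ᶜ) := by
    refine tendsto_nhdsWithin_iff.2 ⟨?_, Filter.Eventually.of_forall fun k => ?_⟩
    · simpa [one_div] using tendsto_one_div_add_atTop_nhds_zero_nat (𝕜 := ℝ)
    · have : (k : ℝ) + 1 ≠ 0 := by positivity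
      simpa using this
  simpa [Function.comp_def] using h.comp h0

theorem measurable_seqLineDeriv {Z : Type*} [MeasurableSpace Z] {φ : Z → Param p → ℝ}
    (hφ : ∀ θ, Measurable fun x => φ x θ) (v θ : Param p) :
    Measurable fun x => seqLineDeriv (φ x) v θ :=
  Measurable.limsup fun _ => measurable_const.mul ((hφ _).sub (hφ _))

/-- The Hessian form of a twice differentiable function is an iterated sequential limit, so it agrees
with a quantity that is measurable in the data. -/
theorem seqLineDeriv_seqLineDeriv {g : Param p → ℝ} (hg : TwiceDifferentiable g)
    (θ w v : Param p) :
    seqLineDeriv (seqLineDeriv g w) v θ = inner ℝ w (hessian g θ v) := by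
  have h1 : seqLineDeriv g w = fun θ' => inner ℝ w (gradient g θ') := by
    ext θ'
    rw [seqLineDeriv_eq_fderiv (hg.1 θ'), ← toDual_gradient, InnerProductSpace.toDual_apply_apply,
      real_inner_comm]
  have h2 : HasFDerivAt (fun θ' => inner ℝ w (gradient g θ')) ((innerSL ℝ w).comp (hessian g θ)) θ :=
    (innerSL ℝ w).hasFDerivAt.comp θ (hg.2 θ).hasFDerivAt
  rw [h1, seqLineDeriv_eq_fderiv h2.differentiableAt, h2.fderiv]
  rfl

end Measurability

/-! ### The sub-sampled and the full Hessian -/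

section Weights

variable {n : ℕ}

/-- The weights for which `∑ i, w i • A i` is the mean of `A` over `s` minus its mean over all
indices. -/
noncomputable def meanDiffWeight (s : Finset (Fin n)) (i : Fin n) : ℝ :=
  (if i ∈ s then (s.card : ℝ)⁻¹ else 0) - (n : ℝ)⁻¹

theorem cast_ne_zero_of_nonempty {s : Finset (Fin n)} (hs : s.Nonempty) : (n : ℝ) ≠ 0 := by
  obtain ⟨i, _⟩ := hs
  exact Nat.cast_ne_zero.2 i.pos.ne'

theorem sum_meanDiffWeight {s : Finset (Fin n)} (hs : s.Nonempty) :
    ∑ i, meanDiffWeight s i = 0 := by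
  have hm : (s.card : ℝ) ≠ 0 := Nat.cast_ne_zero.2 hs.card_pos.ne'
  simp [meanDiffWeight, Finset.sum_sub_distrib, hm, cast_ne_zero_of_nonempty hs]

theorem sum_sq_meanDiffWeight_le {s : Finset (Fin n)} (hs : s.Nonempty) :
    ∑ i, meanDiffWeight s i ^ 2 ≤ (s.card : ℝ)⁻¹ := by
  have hm : (s.card : ℝ) ≠ 0 := Nat.cast_ne_zero.2 hs.card_pos.ne'
  have hn := cast_ne_zero_of_nonempty hs
  have h : ∀ i, meanDiffWeight s i ^ 2 = (if i ∈ s then (s.card : ℝ)⁻¹ ^ 2 else 0) -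
      2 * (n : ℝ)⁻¹ * (if i ∈ s then (s.card : ℝ)⁻¹ else 0) + (n : ℝ)⁻¹ ^ 2 := fun i => by
    unfold meanDiffWeight; split_ifs <;> ring
  simp only [h, Finset.sum_add_distrib, Finset.sum_sub_distrib, ← Finset.mul_sum]
  simp only [Finset.sum_ite_mem, Finset.univ_inter, Finset.sum_const, Finset.card_univ,
    Fintype.card_fin, nsmul_eq_mul]
  have : (0 : ℝ) ≤ (n : ℝ)⁻¹ := by positivity
  field_simp
  field_simp at this
  linarith

theorem subHessian_sub_subHessian_univ {p : ℕ} (f : Fin n → Param p → ℝ) (s : Finset (Fin n))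
    (θ : Param p) : subHessian f s θ - subHessian f Finset.univ θ =
      ∑ i, meanDiffWeight s i • hessian (f i) θ := by
  have h : ∀ i, meanDiffWeight s i • hessian (f i) θ =
      (if i ∈ s then (s.card : ℝ)⁻¹ • hessian (f i) θ else 0) - (n : ℝ)⁻¹ • hessian (f i) θ :=
    fun i => by
      rw [meanDiffWeight]
      split_ifs
      · exact ContinuousLinearMap.ext fun x => by
          rw [smul_apply, sub_apply, smul_apply, smul_apply, sub_smul]
      · exact ContinuousLinearMap.ext fun x => by simp
  simp [h, subHessian, Finset.sum_sub_distrib, Finset.smul_sum]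

end Weights

/-- The numerical inequality of the union bound: the net of `C` has at most `(1 + 2√L)^p` points,
the two nets of the unit ball at most `9^p` each, and each tail probability is `exp (-8 p log L)`. It
rests on `1 + 2√L ≤ 3√L` and `3 * 81 ≤ exp 6`. -/
theorem covering_mul_exp_le {p : ℕ} {L : ℝ} (hL : Real.exp 1 ≤ L) :
    (1 + 2 * √L) ^ p * (9 ^ p * 9 ^ p) * Real.exp (-(8 * (p * Real.log L))) ≤
      Real.exp (-(p : ℝ)) := by
  have hL0 : 0 < L := (Real.exp_pos 1).trans_le hL
  have hl : 1 ≤ Real.log L := by rwa [Real.le_log_iff_exp_le hL0]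
  have hs : √L = Real.exp (Real.log L / 2) := by
    rw [Real.exp_half, Real.exp_log hL0]
  have h1 : 1 ≤ √L := by rw [hs]; exact Real.one_le_exp (by linarith)
  have h6 : (243 : ℝ) ≤ Real.exp 6 := by
    have : Real.exp 6 = Real.exp 1 ^ 6 := by rw [← Real.exp_nat_mul]; norm_num
    rw [this]
    calc (243 : ℝ) ≤ 2.7 ^ 6 := by norm_num
      _ ≤ _ := by gcongr; linarith [Real.exp_one_gt_d9]
  have h2 : (1 + 2 * √L) * (9 * 9) ≤ Real.exp (6 + Real.log L / 2) := by
    rw [Real.exp_add, ← hs]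
    nlinarith
  calc _ = ((1 + 2 * √L) * (9 * 9)) ^ p * Real.exp (-(8 * (p * Real.log L))) := by
        rw [mul_pow, mul_pow]
    _ ≤ Real.exp (6 + Real.log L / 2) ^ p * Real.exp (-(8 * (p * Real.log L))) := by gcongr
    _ = Real.exp (p * (6 + Real.log L / 2 - 8 * Real.log L)) := by
        rw [← Real.exp_nat_mul, ← Real.exp_add]; ring_nf
    _ ≤ Real.exp (-(p : ℝ)) := by
        rw [Real.exp_le_exp]
        have : (0 : ℝ) ≤ p := by positivity
        nlinarith

/-! ### Uniform deviation over the parameter set -/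

section Deviation

variable {n p : ℕ} {Ω : Type*} [MeasurableSpace Ω] {P : Measure Ω} [IsProbabilityMeasure P]
  {Z : Type*} [MeasurableSpace Z] {D : Measure Z} {z : Fin n → Ω → Z} {φ : Z → Param p → ℝ}
  {f : Ω → Fin n → Param p → ℝ} {C : Set (Param p)} {M : ℕ → ℝ} {K : ℝ}

/-- Tail bound for one entry of the difference of the two Hessians, at a fixed parameter. -/
theorem measureReal_weighted_hessian_ge_le (hz : ∀ i, Measurable (z i))
    (hD : ∀ i, P.map (z i) = D) (hind : iIndepFun z P) (hφ : ∀ θ, Measurable fun x => φ x θ)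
    (hf : ∀ ω i, f ω i = φ (z i ω)) (hdiff : ∀ᵐ ω ∂P, ∀ i, TwiceDifferentiable (f ω i))
    (hK : 0 < K) (hbound : ∀ᵐ ω ∂P, ∀ i, ∀ θ ∈ C, ‖hessian (f ω i) θ‖ ≤ K)
    {s : Finset (Fin n)} (hs : s.Nonempty) {θ u v : Param p} (hθ : θ ∈ C) (hu : ‖u‖ ≤ 1)
    (hv : ‖v‖ ≤ 1) {ε : ℝ} (hε : 0 ≤ ε) :
    P.real {ω | ε ≤ ∑ i, meanDiffWeight s i * seqLineDeriv (seqLineDeriv (φ (z i ω)) u) v θ} ≤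
      Real.exp (-(s.card * ε ^ 2 / (2 * K ^ 2))) := by
  set F : Z → ℝ := fun x => seqLineDeriv (seqLineDeriv (φ x) u) v θ with hF
  have hFm : Measurable F := measurable_seqLineDeriv (measurable_seqLineDeriv hφ u) v θ
  have hb : ∀ i, ∀ᵐ ω ∂P, |F (z i ω)| ≤ K := fun i => by
    filter_upwards [hdiff, hbound] with ω h1 h2
    have h1 := h1 i
    have h2 := h2 i θ hθ
    rw [hf] at h1 h2
    rw [hF]
    simp only
    rw [seqLineDeriv_seqLineDeriv h1]
    calc _ ≤ ‖u‖ * ‖hessian (φ (z i ω)) θ v‖ := abs_real_inner_le_norm _ _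
      _ ≤ 1 * (K * 1) := by
          gcongr
          exact (ContinuousLinearMap.le_opNorm _ _).trans (by gcongr)
      _ = K := by ring
  have hmean : ∀ i, P[fun ω => F (z i ω)] = ∫ x, F x ∂D := fun i => by
    rw [← hD i, integral_map (hz i).aemeasurable hFm.aestronglyMeasurable]
  have := measureReal_weighted_sum_ge_le (hind.comp (fun _ => F) fun _ => hFm)
    (fun i => (hFm.comp (hz i)).aemeasurable) hK.le hb hmean (sum_meanDiffWeight hs)
    (sum_sq_meanDiffWeight_le hs) hε
  refine this.trans (le_of_eq ?_)
  have hm : (s.card : ℝ) ≠ 0 := Nat.cast_ne_zero.2 hs.card_pos.ne'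
  congr 1
  field_simp

/-- For a fixed sub-sample `s`, outside a measurable set of data of probability at most `exp (-p)` the
sub-sampled and the full Hessian are close uniformly on `C`. The constant `17` is `4 * 4 + 1`: Hoeffding
at level `4 K σ`, times `4` for the passage from the net to the operator norm, and `1` for the
discretization of `C`. -/
theorem exists_measurableSet_subHessian_deviation (hz : ∀ i, Measurable (z i))
    (hD : ∀ i, P.map (z i) = D) (hind : iIndepFun z P) (hφ : ∀ θ, Measurable fun x => φ x θ)
    (hf : ∀ ω i, f ω i = φ (z i ω)) (hdiff : ∀ᵐ ω ∂P, ∀ i, TwiceDifferentiable (f ω i))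
    (hC : Bornology.IsBounded C)
    (hM : ∀ᵐ ω ∂P, ∀ S : Finset (Fin n), S.Nonempty → ∀ θ ∈ C, ∀ θ' ∈ C,
      ‖subHessian (f ω) S θ - subHessian (f ω) S θ'‖ ≤ M S.card * ‖θ - θ'‖)
    (hK : 0 < K) (hbound : ∀ᵐ ω ∂P, ∀ i, ∀ θ ∈ C, ‖hessian (f ω i) θ‖ ≤ K)
    {s : Finset (Fin n)} (hs : s.Nonempty) (hp : 0 < p)
    (hL : Real.exp 1 ≤ logArgument C M K n s.card) :
    ∃ B : Set (Fin n → Z), MeasurableSet B ∧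
      P ((fun ω i => z i ω) ⁻¹' B) ≤ ENNReal.ofReal (Real.exp (-(p : ℝ))) ∧
      ∀ᵐ ω ∂P, (fun i => z i ω) ∉ B → ∀ θ ∈ C,
        ‖subHessian (f ω) s θ - subHessian (f ω) Finset.univ θ‖ ≤
          17 * K * √((p : ℝ) / s.card * Real.log (logArgument C M K n s.card)) := by
  classical
  set m : ℝ := (s.card : ℝ) with hm
  set L := logArgument C M K n s.card with hLdef
  set σ := √((p : ℝ) / m * Real.log L) with hσ
  have hm0 : 0 < m := Nat.cast_pos.2 hs.card_pos
  have hp1 : (1 : ℝ) ≤ p := Nat.one_le_cast.2 hp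
  have hL0 : 0 < L := (Real.exp_pos 1).trans_le hL
  have hl : 1 ≤ Real.log L := by rwa [Real.le_log_iff_exp_le hL0]
  -- with the absolute value, the signs of the Lipschitz constants do not matter
  set R := |M n + M s.card| with hR
  have hLR : L = (diam C * R * √m / K) ^ 2 := by
    rw [hLdef, logArgument, div_pow, mul_pow, mul_pow, Real.sq_sqrt hm0.le, hR, sq_abs]
  have hR0 : 0 < R := by
    refine (abs_nonneg _).lt_of_ne' fun h => hL0.ne' ?_
    rw [hLR, hR, h]; simp
  have hsm : 0 < √m := Real.sqrt_pos.2 hm0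
  have hδ : 0 < K / (R * √m) := by positivity
  obtain ⟨N, hNC, hNcard, hNnet⟩ := exists_finset_net hC hδ
  obtain ⟨U, hU1, hUcard, hUnet⟩ := exists_finset_net (C := closedBall (0 : Param p) 1)
    isBounded_closedBall (δ := 1 / 2) (by norm_num)
  have hNcard' : (N.card : ℝ) ≤ (1 + 2 * √L) ^ p := by
    have e : √L = diam C / (K / (R * √m)) := by
      rw [hLR, Real.sqrt_sq (by have : 0 ≤ diam C := diam_nonneg
                                positivity)]
      field_simp
    rw [e, ← mul_div_assoc]
    simpa using hNcard
  have hUcard' : (U.card : ℝ) ≤ 9 ^ p := by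
    refine hUcard.trans ?_
    rw [finrank_euclideanSpace_fin]
    have : diam (closedBall (0 : Param p) 1) ≤ 2 * 1 := diam_closedBall zero_le_one
    have h0 : 0 ≤ diam (closedBall (0 : Param p) 1) := diam_nonneg
    gcongr
    linarith
  have hU1' : ∀ u ∈ U, ‖u‖ ≤ 1 := fun u hu => mem_closedBall_zero_iff.1 (hU1 hu)
  let F : Param p × Param p × Param p → Z → ℝ :=
    fun q x => seqLineDeriv (seqLineDeriv (φ x) q.2.1) q.2.2 q.1
  have hFm : ∀ q, Measurable (F q) := fun q =>
    measurable_seqLineDeriv (measurable_seqLineDeriv hφ q.2.1) q.2.2 q.1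
  let B : Set (Fin n → Z) := ⋃ q ∈ N ×ˢ U ×ˢ U,
    {y | 4 * K * σ ≤ ∑ i, meanDiffWeight s i * F q (y i)}
  have hε : 0 ≤ 4 * K * σ := by positivity
  -- this turns the Hoeffding exponent at level `4 K σ` into `8 p log L`
  have hσ2 : m * σ ^ 2 = p * Real.log L := by
    rw [hσ, Real.sq_sqrt (by positivity)]; field_simp
  refine ⟨B, ?_, ?_, ?_⟩
  · refine Finset.measurableSet_biUnion _ fun q _ => measurableSet_le measurable_const ?_
    exact Finset.measurable_sum _ fun i _ =>
      measurable_const.mul ((hFm q).comp (measurable_pi_apply i))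
  · have h1 : P.real ((fun ω i => z i ω) ⁻¹' B) ≤ Real.exp (-(p : ℝ)) := by
      simp only [B, Set.preimage_iUnion₂]
      calc _ ≤ ∑ q ∈ N ×ˢ U ×ˢ U, P.real ((fun ω i => z i ω) ⁻¹'
              {y | 4 * K * σ ≤ ∑ i, meanDiffWeight s i * F q (y i)}) :=
            measureReal_biUnion_finset_le _ _
        _ ≤ ∑ q ∈ N ×ˢ U ×ˢ U, Real.exp (-(8 * (p * Real.log L))) := by
            refine Finset.sum_le_sum fun q hq => ?_
            simp only [Finset.mem_product] at hq
            refine (measureReal_weighted_hessian_ge_le hz hD hind hφ hf hdiff hK hbound hs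
              (hNC hq.1) (hU1' _ hq.2.1) (hU1' _ hq.2.2) hε).trans (le_of_eq ?_)
            rw [← hσ2]
            congr 2
            field_simp
            ring
        _ = N.card * (U.card * U.card) * Real.exp (-(8 * (p * Real.log L))) := by
            simp [Finset.card_product]
        _ ≤ (1 + 2 * √L) ^ p * (9 ^ p * 9 ^ p) * Real.exp (-(8 * (p * Real.log L))) := by
            gcongr
        _ ≤ _ := covering_mul_exp_le hL
    rw [← ofReal_measureReal]
    exact ENNReal.ofReal_le_ofReal h1
  · filter_upwards [hdiff, hM] with ω h1 h2 hB θ hθ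
    obtain ⟨θ₀, hθ₀, hd⟩ := hNnet θ hθ
    have h3 : ‖subHessian (f ω) s θ₀ - subHessian (f ω) Finset.univ θ₀‖ ≤ 4 * (4 * K * σ) := by
      refine norm_le_four_mul_of_inner_net_le hUnet _ hε fun u hu v hv => ?_
      have h4 : ¬ 4 * K * σ ≤ ∑ i, meanDiffWeight s i * F (θ₀, u, v) (z i ω) := fun hcon =>
        hB (Set.mem_iUnion₂.2 ⟨(θ₀, u, v), by simp_all, hcon⟩)
      refine le_trans (le_of_eq ?_) (not_le.1 h4).le
      rw [subHessian_sub_subHessian_univ, sum_apply, inner_sum]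
      refine Finset.sum_congr rfl fun i _ => ?_
      rw [smul_apply, real_inner_smul_right, ← seqLineDeriv_seqLineDeriv (h1 i), hf]
    have hn : (Finset.univ : Finset (Fin n)).Nonempty := hs.mono (Finset.subset_univ s)
    have h5 := h2 s hs θ hθ θ₀ (hNC hθ₀)
    have h6 := h2 _ hn θ hθ θ₀ (hNC hθ₀)
    rw [Finset.card_univ, Fintype.card_fin] at h6
    have h7 : (M n + M s.card) * ‖θ - θ₀‖ ≤ K * σ := by
      calc _ ≤ R * (K / (R * √m)) := by
            gcongr
            exact le_abs_self _
        _ = K * (1 / √m) := by field_simp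
        _ ≤ K * σ := by
            gcongr
            rw [hσ, ← Real.sqrt_one, ← Real.sqrt_div zero_le_one]
            apply Real.sqrt_le_sqrt
            rw [div_mul_eq_mul_div]
            gcongr
            nlinarith
    have e : subHessian (f ω) s θ - subHessian (f ω) Finset.univ θ =
        (subHessian (f ω) s θ₀ - subHessian (f ω) Finset.univ θ₀) +
        (subHessian (f ω) s θ - subHessian (f ω) s θ₀) -
        (subHessian (f ω) Finset.univ θ - subHessian (f ω) Finset.univ θ₀) := by abel
    rw [e]
    linarith [norm_sub_le ((subHessian (f ω) s θ₀ - subHessian (f ω) Finset.univ θ₀) +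
        (subHessian (f ω) s θ - subHessian (f ω) s θ₀))
        (subHessian (f ω) Finset.univ θ - subHessian (f ω) Finset.univ θ₀),
      norm_add_le (subHessian (f ω) s θ₀ - subHessian (f ω) Finset.univ θ₀)
        (subHessian (f ω) s θ - subHessian (f ω) s θ₀)]

end Deviation

/-! ### The random sub-sample -/

/-- If each exceptional set `B s` has probability at most `b` and `S` is independent of `ζ`, then so has
the event that `ζ` lies in the set selected by `S`. -/
theorem measure_iUnion_inter_le_of_indepFun {Ω ι Y : Type*} [MeasurableSpace Ω] {P : Measure Ω}
    [IsProbabilityMeasure P] [Fintype ι] [MeasurableSpace ι] [MeasurableSingletonClass ι]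
    [MeasurableSpace Y] {S : Ω → ι} (hS : Measurable S) {ζ : Ω → Y} (h : IndepFun S ζ P)
    {B : ι → Set Y} (hB : ∀ s, MeasurableSet (B s)) {b : ENNReal}
    (hb : ∀ s, P (ζ ⁻¹' B s) ≤ b) : P (⋃ s, S ⁻¹' {s} ∩ ζ ⁻¹' B s) ≤ b := by
  calc _ ≤ ∑ s, P (S ⁻¹' {s} ∩ ζ ⁻¹' B s) := measure_iUnion_fintype_le _ _
    _ = ∑ s, P (S ⁻¹' {s}) * P (ζ ⁻¹' B s) := Finset.sum_congr rfl fun s _ =>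
        h.measure_inter_preimage_eq_mul _ _ (measurableSet_singleton s) (hB s)
    _ ≤ ∑ s, P (S ⁻¹' {s}) * b := by gcongr with s; exact hb s
    _ = b := by
        rw [← Finset.sum_mul, sum_measure_preimage_singleton _ fun s _ => hS (measurableSet_singleton s)]
        simp

end NewSamp

theorem theorem2 :
    -- the absolute constants
    ∃ c c' : ℝ, 0 < c ∧ 0 < c' ∧
      ∀ (n p r : ℕ) (hr : r < p)
        {Ω : Type*} [MeasurableSpace Ω] (P : Measure Ω) [IsProbabilityMeasure P]
        {Z : Type*} [MeasurableSpace Z] (D : Measure Z)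
        -- i.i.d. observations from `D`, and the functions `f_i = φ(z_i, ·)`
        (z : Fin n → Ω → Z) (_ : ∀ i, Measurable (z i))
        (_ : ∀ i, P.map (z i) = D) (_ : iIndepFun z P)
        (φ : Z → NewSamp.Param p → ℝ) (_ : ∀ θ, Measurable fun x => φ x θ)
        (f : Ω → Fin n → NewSamp.Param p → ℝ) (_ : ∀ ω i, f ω i = φ (z i ω))
        (_ : ∀ᵐ ω ∂P, ∀ i, NewSamp.TwiceDifferentiable (f ω i))
        -- the parameter set
        (C : Set (NewSamp.Param p)) (_ : Convex ℝ C) (_ : Bornology.IsBounded C)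
        -- Lipschitz continuity of the sub-sampled Hessians, bounded Hessians
        (M : ℕ → ℝ) (_ : ∀ᵐ ω ∂P, ∀ S : Finset (Fin n), S.Nonempty → ∀ θ ∈ C, ∀ θ' ∈ C,
          ‖NewSamp.subHessian (f ω) S θ - NewSamp.subHessian (f ω) S θ'‖ ≤ M S.card * ‖θ - θ'‖)
        (K : ℝ) (_ : 0 < K)
        (_ : ∀ᵐ ω ∂P, ∀ i, ∀ θ ∈ C, ‖NewSamp.hessian (f ω i) θ‖ ≤ K)
        -- the sub-samples: a random sequence of sets, of any joint law, independent of the data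
        (S : ℕ → Ω → Finset (Fin n)) (_ : ∀ τ, Measurable (S τ))
        (_ : IndepFun (fun ω τ => S τ ω) (fun ω i => z i ω) P)
        (_ : ∀ᵐ ω ∂P, ∀ τ, (S τ ω).Nonempty)
        -- a minimizer of the objective over `ℝ^p`, and the event that it lies in `C`
        (θstar : Ω → NewSamp.Param p)
        (_ : ∀ᵐ ω ∂P, θstar ω ∈ C → ∀ θ,
          NewSamp.objective (f ω) (θstar ω) ≤ NewSamp.objective (f ω) θ)
        (_ : MeasurableSet {ω | θstar ω ∈ C}) (_ : P {ω | θstar ω ∈ C} ≠ 0)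
        -- the iterates `θhat 0, …, θhat (t + 1)` of NewSamp
        (t : ℕ) (η : ℕ → Ω → ℝ) (lam : ℕ → Ω → Fin p → ℝ)
        (u : ℕ → Ω → OrthonormalBasis (Fin p) ℝ (NewSamp.Param p))
        (θhat : ℕ → Ω → NewSamp.Param p) (_ : ∀ᵐ ω ∂P, θhat 0 ω ∈ C)
        (_ : ∀ᵐ ω ∂P, ∀ τ ≤ t, NewSamp.IsStep (f ω) C hr (S τ ω) (η τ ω) (lam τ ω) (u τ ω)
          (θhat τ ω) (θhat (τ + 1) ω))
        -- the logarithm in the linear coefficient is at least `1`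
        (_ : ∀ᵐ ω ∂P, Real.exp 1 ≤ NewSamp.logArgument C M K n (S t ω).card),
        NewSamp.HoldsWithProbAtLeast (P[|{ω | θstar ω ∈ C}])
          (1 - c / P.real {ω | θstar ω ∈ C} * Real.exp (-(p : ℝ)))
          {ω | 0 < NewSamp.thresholdEigenvalue hr (lam t ω) →
            0 ≤ η t ω →
            η t ω ≤ 2 / (1 + NewSamp.smallestEigenvalue hr (lam t ω) /
              NewSamp.thresholdEigenvalue hr (lam t ω)) →
            ‖θhat (t + 1) ω - θstar ω‖ ≤
              NewSamp.xi₁ c' hr C M K n (S t ω).card (η t ω) (lam t ω) * ‖θhat t ω - θstar ω‖ +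
                NewSamp.xi₂ hr M n (η t ω) (lam t ω) * ‖θhat t ω - θstar ω‖ ^ 2} := by
  refine ⟨1, 17, one_pos, by norm_num, ?_⟩
  intro n p r hr Ω _ P _ Z _ D z hz hD hind φ hφ f hf hdiff C hCconv hCb M hM K hK hbound S hS hSz
    hSne θstar hmin hE hE0 t η lam u θhat hinit hstep hlog
  classical
  have hp : 0 < p := by omega
  -- an exceptional set of data for each value of the sub-sample, empty for the values that the
  -- hypotheses exclude
  have hB : ∀ s : Finset (Fin n), ∃ B : Set (Fin n → Z), MeasurableSet B ∧
      P ((fun ω i => z i ω) ⁻¹' B) ≤ ENNReal.ofReal (Real.exp (-(p : ℝ))) ∧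
      (s.Nonempty → Real.exp 1 ≤ NewSamp.logArgument C M K n s.card →
        ∀ᵐ ω ∂P, (fun i => z i ω) ∉ B → ∀ θ ∈ C,
          ‖NewSamp.subHessian (f ω) s θ - NewSamp.subHessian (f ω) Finset.univ θ‖ ≤
            17 * K * √((p : ℝ) / s.card * Real.log (NewSamp.logArgument C M K n s.card))) := by
    intro s
    by_cases h : s.Nonempty ∧ Real.exp 1 ≤ NewSamp.logArgument C M K n s.card
    · obtain ⟨B, h1, h2, h3⟩ := NewSamp.exists_measurableSet_subHessian_deviation hz hD hind hφ hf
        hdiff hCb hM hK hbound h.1 hp h.2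
      exact ⟨B, h1, h2, fun _ _ => h3⟩
    · exact ⟨∅, MeasurableSet.empty, by simp, fun h1 h2 => absurd ⟨h1, h2⟩ h⟩
  choose B hBm hBP hBdev using hB
  have hdev : ∀ᵐ ω ∂P, ∀ s : Finset (Fin n), s.Nonempty →
      Real.exp 1 ≤ NewSamp.logArgument C M K n s.card → (fun i => z i ω) ∉ B s → ∀ θ ∈ C,
          ‖NewSamp.subHessian (f ω) s θ - NewSamp.subHessian (f ω) Finset.univ θ‖ ≤
            17 * K * √((p : ℝ) / s.card * Real.log (NewSamp.logArgument C M K n s.card)) := by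
    rw [ae_all_iff]
    intro s
    by_cases h : s.Nonempty ∧ Real.exp 1 ≤ NewSamp.logArgument C M K n s.card
    · filter_upwards [hBdev s h.1 h.2] with ω hω _ _ using hω
    · exact Filter.Eventually.of_forall fun ω h1 h2 => absurd ⟨h1, h2⟩ h
  have hind' : IndepFun (S t) (fun ω i => z i ω) P :=
    hSz.comp (φ := fun x : ℕ → Finset (Fin n) => x t) (measurable_pi_apply t) measurable_id
  have hbad := NewSamp.measure_iUnion_inter_le_of_indepFun (hS t) hind' hBm hBP
  set E : Set Ω := {ω | θstar ω ∈ C} with hEdef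
  have hEpos : 0 < P.real E := ENNReal.toReal_pos hE0 (measure_ne_top P E)
  rw [NewSamp.HoldsWithProbAtLeast, cond_apply hE, sub_sub_cancel]
  have hrhs : ENNReal.ofReal (1 / P.real E * Real.exp (-(p : ℝ))) =
      (P E)⁻¹ * ENNReal.ofReal (Real.exp (-(p : ℝ))) := by
    rw [ENNReal.ofReal_mul (by positivity), one_div, ENNReal.ofReal_inv_of_pos hEpos,
      ofReal_measureReal]
  rw [hrhs]
  gcongr
  refine le_trans (measure_mono_ae ?_) hbad
  filter_upwards [hdiff, hM, hSne, hmin, hinit, hstep, hlog, hdev] with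
    ω h1 h2 h3 h4 h5 h6 h7 h8
  rintro ⟨hωE, hωA⟩
  by_contra hcon
  refine hωA ?_
  have hzB : (fun i => z i ω) ∉ B (S t ω) := fun h =>
    hcon (Set.mem_iUnion.2 ⟨S t ω, rfl, h⟩)
  have hθ : θhat t ω ∈ C := by
    cases t with
    | zero => exact h5
    | succ k => exact (h6 k (Nat.le_succ k)).update.1
  intro h0 hη hη'
  have hn : (Finset.univ : Finset (Fin n)).Nonempty := (h3 t).mono (Finset.subset_univ _)
  refine ((h6 t le_rfl).norm_sub_le h1 hCconv hθ hωE (h4 hωE) (M := M) ?_ h0 hη hη'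
    (h8 (S t ω) (h3 t) h7 hzB _ hθ)).trans (le_of_eq ?_)
  · simpa using h2 Finset.univ hn
  · rw [NewSamp.xi₁]
    ring
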